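/- Let $L_1$, $L_2$ be relational first-order vocabularies, let $M,N$ be unary and $T$ a binary predicate symbol (all new), and let $\Sigma$ be a first-order theory with identity in the vocabulary $\{L_1,L_2,T,M,N\}$. We write $Tb=a$ for $T(b,a)$. All ambient domains are non-empty. Call an interpretation of this vocabulary on a domain $D$ *orderly* if $M,N\subseteq D$ are disjoint, the $L_1$-predicates hold only of tuples inside $N$, the $L_2$-predicates hold only of tuples inside $M$, and $T\subseteq M\times N$. Assume that $\Sigma$ defines a transformation of $L_2$-models into $L_1$-models: - every model of $\Sigma$ is orderly, and in every model of $\Sigma$ the relation $T$ is (the graph of) a function from $M$ onto $N$; - apart from this, $\Sigma$ only makes assertions about the objects in $M\cup N$: an orderly structure is a model of $\Sigma$ if and only if its restriction to $M\cup N$ is (for example, $\Sigma$ consists of the conditions of orderliness and of sentences whose quantifiers are bounded by $M\vee N$). In a model of $\Sigma$, the source model is the set $M$ with its $L_2$-predicates, and the target model is the set $N$ with its $L_1$-predicates. Say that an $n$-ary relation $P$ on target models (an $L_1$-predicate, or identity, with $n=2$) is *implicitly definable across models* if the following consequence holds on every domain: whenever $(L_1,L_2,T,M,N)$ and $(L_1',L_2',T',M',N')$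 are two interpretations on this domain that both satisfy $\Sigma$, $Z$ is an $L_2$-isomorphism from the source model $M$ onto the source model $M'$, and $b_i\in M$, $a_i\in N$, $b_i'\in M'$, $a_i'\in N'$ ($1\le i\le n$) satisfy $Tb_i=a_i$, $b_i\,Z\,b_i'$ and $T'b_i'=a_i'$, then $P(a_1,\dots,a_n)$ implies $P'(a_1',\dots,a_n')$. For an $L_2$-formula $\delta$, let $\delta^M$ be $\delta$ with all quantifiers bounded by $M$. An *explicit $L_2$-definition* of $P$ is an $L_2$-formula $\delta(x_1,\dots,x_n)$ such that $$\Sigma\models\forall\bar x\,\forall\bar y\,\Bigl(\bigwedge_{i} Tx_i=y_i\;\to\;\bigl(P\bar y\leftrightarrow\delta^M(\bar x)\bigr)\Bigr).$$ Then: 1. Every $L_1$-predicate that is implicitly definable across models has an explicit $L_2$-definition. 2. If all $L_1$-predicates are implicitly definable across models, then there are $L_2$-formulas $\delta_P$, for the $L_1$-predicates $P$, and $\varepsilon(x_1,x_2)$ such that each $\delta_P$ is an explicit $L_2$-definition of $P$, and such that the compositional translation $\tau$ of $L_1$-formulas into $L_2$-formulas that replaces each atom $P(z_1,\dots,z_n)$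 by $\delta_P(z_1,\dots,z_n)$ and each atom $z_1=z_2$ by $\varepsilon(z_1,z_2)$, and that commutes with the Boolean operations and the quantifiers, satisfies the equivalence $$M\models\tau(\varphi)(b)\iff N\models\varphi(a)\qquad(\#)$$ for all $L_1$-formulas $\varphi$ in which the identity symbol does not occur, all models of $\Sigma$ with source model $M$ and target model $N$, and all assignments $b$ in $M$ and $a$ in $N$ with $Tb=a$ pointwise. If, moreover, identity on the target models is implicitly definable across models, then $\varepsilon$ is an explicit $L_2$-definition of it, and (#) holds for all $L_1$-formulas with identity. -/

import Mathlib

open FirstOrder.Language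
open scoped FirstOrder

universe u₁ v₁ u₂ v₂ w

namespace CrossModel

/-- The three additional predicate symbols: `src` (written `M`) for the domain of the source model,
`tgt` (written `N`) for the domain of the target model, and `map` (written `T`) for the graph of
the transformation on objects, so that `T b = a` is the atomic formula `map b a`. -/
inductive RoleRel : ℕ → Type
  | src : RoleRel 1
  | tgt : RoleRel 1
  | map : RoleRel 2

/-- The relational language with the symbols `M`, `N`, `T`. -/
def roleLang : FirstOrder.Language.{0, 0} := ⟨fun _ => Empty, RoleRel⟩

instance : roleLang.IsRelational := fun _ => inferInstanceAs (IsEmpty Empty)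

/-- The vocabulary `{L₁, L₂, T, M, N}`. -/
abbrev sig (L₁ : FirstOrder.Language.{u₁, v₁}) (L₂ : FirstOrder.Language.{u₂, v₂}) :
    FirstOrder.Language.{max u₁ u₂, max v₁ v₂} :=
  (L₁.sum L₂).sum roleLang

section Vocabulary

variable {L₁ : FirstOrder.Language.{u₁, v₁}} {L₂ : FirstOrder.Language.{u₂, v₂}}

/-- The symbol `M` of the joint vocabulary. -/
def srcSym : (sig L₁ L₂).Relations 1 := Sum.inr RoleRel.src

/-- The symbol `N` of the joint vocabulary. -/
def tgtSym : (sig L₁ L₂).Relations 1 := Sum.inr RoleRel.tgt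

/-- The symbol `T` of the joint vocabulary. -/
def mapSym : (sig L₁ L₂).Relations 2 := Sum.inr RoleRel.map

/-- An `L₁`-predicate as a symbol of the joint vocabulary. -/
def sym₁ {n : ℕ} (P : L₁.Relations n) : (sig L₁ L₂).Relations n := Sum.inl (Sum.inl P)

/-- The inclusion of `L₂` into the joint vocabulary. -/
def incl₂ : L₂ →ᴸ sig L₁ L₂ := LHom.sumInl.comp LHom.sumInr

/-- An `L₂`-predicate as a symbol of the joint vocabulary. -/
def sym₂ {n : ℕ} (Q : L₂.Relations n) : (sig L₁ L₂).Relations n := Sum.inl (Sum.inr Q)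

end Vocabulary

section Semantics

variable {L₁ : FirstOrder.Language.{u₁, v₁}} {L₂ : FirstOrder.Language.{u₂, v₂}} {D : Type w}

/-- The interpretation of `M`. -/
def srcSet (S : (sig L₁ L₂).Structure D) : Set D := {x | S.RelMap srcSym ![x]}

/-- The interpretation of `N`. -/
def tgtSet (S : (sig L₁ L₂).Structure D) : Set D := {x | S.RelMap tgtSym ![x]}

/-- `T x = y`. -/
def MapsTo (S : (sig L₁ L₂).Structure D) (x y : D) : Prop := S.RelMap mapSym ![x, y]

/-- The structure `(D, S)` is a model of the theory `Σ`. -/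
def Sat (S : (sig L₁ L₂).Structure D) (Th : (sig L₁ L₂).Theory) : Prop :=
  @Theory.Model (sig L₁ L₂) D S Th

/-- Restriction of a structure for a relational language to a subset of its domain. -/
@[reducible] def restrict {L : FirstOrder.Language.{u₁, v₁}} [L.IsRelational] (S : L.Structure D)
    (s : Set D) : L.Structure s where
  funMap := fun f _ => isEmptyElim f
  RelMap := fun R xs => S.RelMap R (fun i => (xs i : D))

/-- The domain of the source model inside `(D, S)`. -/
abbrev Src (S : (sig L₁ L₂).Structure D) : Type w := srcSet S

/-- The domain of the target model inside `(D, S)`. -/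
abbrev Tgt (S : (sig L₁ L₂).Structure D) : Type w := tgtSet S

/-- The source model: the domain `M` with the `L₂`-predicates. -/
instance srcModel [L₂.IsRelational] (S : (sig L₁ L₂).Structure D) : L₂.Structure (Src S) where
  funMap := fun f _ => isEmptyElim f
  RelMap := fun Q xs => S.RelMap (sym₂ Q) (fun i => (xs i).1)

/-- The target model: the domain `N` with the `L₁`-predicates. -/
instance tgtModel [L₁.IsRelational] (S : (sig L₁ L₂).Structure D) : L₁.Structure (Tgt S) where
  funMap := fun f _ => isEmptyElim f
  RelMap := fun P xs => S.RelMap (sym₁ P) (fun i => (xs i).1)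

/-- The book-keeping conditions: `M` and `N` are disjoint, `L₁`-predicates hold only inside `N`,
`L₂`-predicates hold only inside `M`, and `T` only relates objects in `M` to objects in `N`. -/
structure Bookkeeping (S : (sig L₁ L₂).Structure D) : Prop where
  disjoint : Disjoint (srcSet S) (tgtSet S)
  rel₁ : ∀ (n : ℕ) (P : L₁.Relations n) (xs : Fin n → D),
    S.RelMap (sym₁ P) xs → ∀ i, xs i ∈ tgtSet S
  rel₂ : ∀ (n : ℕ) (Q : L₂.Relations n) (xs : Fin n → D),
    S.RelMap (sym₂ Q) xs → ∀ i, xs i ∈ srcSet S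
  map : ∀ x y, MapsTo S x y → x ∈ srcSet S ∧ y ∈ tgtSet S

end Semantics

section Theories

variable {L₁ : FirstOrder.Language.{u₁, v₁}} {L₂ : FirstOrder.Language.{u₂, v₂}}

/-- `Σ` defines a transformation: every model of `Σ` satisfies the book-keeping conditions, in
every model of `Σ` the relation `T` is a function from `M` onto `N`, and (`local_iff`) apart from
the book-keeping conditions `Σ` only makes assertions about the objects in `M ∪ N`, even if a model
itself is larger. The last condition holds, for instance, when `Σ` consists of the book-keeping
conditions and of sentences all of whose quantifiers are bounded by `M ∨ N`. -/
structure DefinesTransformation [L₁.IsRelational] [L₂.IsRelational]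
    (Th : (sig L₁ L₂).Theory) : Prop where
  bookkeeping : ∀ (D : Type (max u₁ v₁ u₂ v₂)) [Nonempty D] (S : (sig L₁ L₂).Structure D),
    Sat S Th → Bookkeeping S
  function : ∀ (D : Type (max u₁ v₁ u₂ v₂)) [Nonempty D] (S : (sig L₁ L₂).Structure D),
    Sat S Th → ∀ x ∈ srcSet S, ∃! y, MapsTo S x y
  onto : ∀ (D : Type (max u₁ v₁ u₂ v₂)) [Nonempty D] (S : (sig L₁ L₂).Structure D),
    Sat S Th → ∀ y ∈ tgtSet S, ∃ x, MapsTo S x y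
  local_iff : ∀ (D : Type (max u₁ v₁ u₂ v₂)) [Nonempty D] (S : (sig L₁ L₂).Structure D),
    Bookkeeping S → (Sat S Th ↔ Sat (restrict S (srcSet S ∪ tgtSet S)) Th)

/-- Implicit cross-model definability of a family of `n`-ary relations `R S` on the target domains:
if `Σ(L₁, L₂, T, M, N)` and `T bᵢ = aᵢ` and `R a`, if `Z` is an `L₂`-isomorphism between `M` and
`M'` with `bᵢ Z bᵢ'`, and if `Σ(L₁', L₂', T', M', N')` and `T' bᵢ' = aᵢ'`, then `R' a'`. As this is
a first-order consequence in one extended vocabulary, both interpretations `S`, `S'` of the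
vocabulary of `Σ` live on one and the same, arbitrary, ambient domain `D`. -/
def Implicit [L₂.IsRelational] (Th : (sig L₁ L₂).Theory) {n : ℕ}
    (R : ∀ {D : Type (max u₁ v₁ u₂ v₂)} (S : (sig L₁ L₂).Structure D), (Fin n → Tgt S) → Prop) :
    Prop :=
  ∀ (D : Type (max u₁ v₁ u₂ v₂)) [Nonempty D] (S S' : (sig L₁ L₂).Structure D),
    Sat S Th → Sat S' Th → ∀ (Z : Src S ≃[L₂] Src S')
      (b : Fin n → Src S) (a : Fin n → Tgt S) (b' : Fin n → Src S') (a' : Fin n → Tgt S'),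
      (∀ i, MapsTo S (b i).1 (a i).1) → (∀ i, Z (b i) = b' i) →
      (∀ i, MapsTo S' (b' i).1 (a' i).1) → R S a → R S' a'

/-- Implicit cross-model definability of the `L₁`-predicate `P`. -/
def ImplicitlyDefinable [L₁.IsRelational] [L₂.IsRelational] (Th : (sig L₁ L₂).Theory) {n : ℕ}
    (P : L₁.Relations n) : Prop :=
  Implicit Th (fun S a => (tgtModel S).RelMap P a)

/-- Implicit cross-model definability of identity, seen as a binary predicate on the target. -/
def IdentityImplicitlyDefinable [L₂.IsRelational] (Th : (sig L₁ L₂).Theory) : Prop :=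
  Implicit (n := 2) Th (fun _ a => a 0 = a 1)

end Theories

section Formulas

variable {L₁ : FirstOrder.Language.{u₁, v₁}} {L₂ : FirstOrder.Language.{u₂, v₂}} {α : Type w}

/-- `δ^M`: the `L₂`-formula `δ` with all its quantifiers bounded by `M`, as a formula of the joint
vocabulary. -/
def relativize : ∀ {n : ℕ}, L₂.BoundedFormula α n → (sig L₁ L₂).BoundedFormula α n
  | _, .falsum => .falsum
  | _, .equal t₁ t₂ => .equal (incl₂.onTerm t₁) (incl₂.onTerm t₂)
  | _, .rel Q ts => .rel (sym₂ Q) (fun i => incl₂.onTerm (ts i))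
  | _, .imp φ ψ => .imp (relativize φ) (relativize ψ)
  | n, .all φ =>
      .all (.imp (srcSym.boundedFormula₁ (.var (.inr (Fin.last n)))) (relativize φ))

/-- The formula `T x₁ = y₁ ∧ … ∧ T xₙ = yₙ`, where `xᵢ` is the variable `inl i` and `yᵢ` is the
variable `inr i`. -/
noncomputable def matching (L₁ : FirstOrder.Language.{u₁, v₁}) (L₂ : FirstOrder.Language.{u₂, v₂}) (n : ℕ) :
    (sig L₁ L₂).Formula (Fin n ⊕ Fin n) :=
  BoundedFormula.iInf (fun i : Fin n => mapSym.formula₂ (.var (.inl i)) (.var (.inr i)))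

/-- `Σ` implies the explicit definition
`∀ x y (T x₁ = y₁ ∧ … ∧ T xₙ = yₙ → (P y₁ … yₙ ↔ δ^M(x₁, …, xₙ)))`. -/
def ExplicitlyDefines (Th : (sig L₁ L₂).Theory) {n : ℕ} (P : L₁.Relations n)
    (δ : L₂.Formula (Fin n)) : Prop :=
  Th ⊨ᵇ (matching L₁ L₂ n).imp
    (((sym₁ P).formula (fun i => Term.var (.inr i))).iff
      (relativize (Formula.relabel Sum.inl δ)))

/-- `Σ` implies the explicit definition
`∀ x y (T x₁ = y₁ ∧ T x₂ = y₂ → (y₁ = y₂ ↔ ε^M(x₁, x₂)))` of identity on the target. -/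
def ExplicitlyDefinesIdentity (Th : (sig L₁ L₂).Theory) (ε : L₂.Formula (Fin 2)) : Prop :=
  Th ⊨ᵇ (matching L₁ L₂ 2).imp
    ((Term.equal (Term.var (.inr 0)) (Term.var (.inr 1))).iff
      (relativize (Formula.relabel Sum.inl ε)))

/-- The variable that a term of a relational language consists of. -/
def termVar {L : FirstOrder.Language.{u₁, v₁}} [L.IsRelational] {β : Type w} : L.Term β → β
  | .var x => x
  | .func f _ => isEmptyElim f

/-- The compositional translation of `L₁`-formulas into `L₂`-formulas given by a formula `δ P` for
each `L₁`-predicate `P` and a formula `ε` for identity: atomic formulas are replaced by their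
definitions, and the translation commutes with the logical operations. -/
def translate [L₁.IsRelational] (δ : ∀ n : ℕ, L₁.Relations n → L₂.Formula (Fin n))
    (ε : L₂.Formula (Fin 2)) : ∀ {n : ℕ}, L₁.BoundedFormula α n → L₂.BoundedFormula α n
  | _, .falsum => .falsum
  | _, .equal t₁ t₂ => BoundedFormula.relabel ![termVar t₁, termVar t₂] ε
  | _, .rel P ts => BoundedFormula.relabel (fun i => termVar (ts i)) (δ _ P)
  | _, .imp φ ψ => .imp (translate δ ε φ) (translate δ ε ψ)
  | _, .all φ => .all (translate δ ε φ)

/-- The identity symbol does not occur in the formula. -/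
def IdentityFree {L : FirstOrder.Language.{u₁, v₁}} : ∀ {n : ℕ}, L.BoundedFormula α n → Prop
  | _, .falsum => True
  | _, .equal _ _ => False
  | _, .rel _ _ => True
  | _, .imp φ ψ => IdentityFree φ ∧ IdentityFree ψ
  | _, .all φ => IdentityFree φ

/-- The equivalence `M ⊨ ψ(b)` iff `N ⊨ φ(T b)`, for all source-target pairs given by `Σ`. -/
def Translates [L₁.IsRelational] [L₂.IsRelational] (Th : (sig L₁ L₂).Theory)
    (φ : L₁.Formula α) (ψ : L₂.Formula α) : Prop :=
  ∀ (D : Type (max u₁ v₁ u₂ v₂)) [Nonempty D] (S : (sig L₁ L₂).Structure D), Sat S Th →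
    ∀ (b : α → Src S) (a : α → Tgt S), (∀ i, MapsTo S (b i).1 (a i).1) →
      (ψ.Realize b ↔ φ.Realize a)

end Formulas

end CrossModel

/-! This is a Beth-type definability theorem. Implicit definability compares two interpretations on
one domain, but `Σ` only speaks about `M ∪ N`. Models on domains `D` and `E` can therefore both be
moved into `D ⊕ E`, so the property also holds across different domains
(`Implicit.of_distinct_domains`).

Suppose that a formula `θ` on the target has no definition over the source. Compactness, used twice,
gives two models of `Σ` with source tuples of the same complete `L₂`-type, where `θ` holds at the
image of one tuple and fails at the image of the other (`DefinesTransformation.exists_definition`).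
By `exists_amalgam`, an elementary extension of the second model has a source model into which the
first source model embeds elementarily, matching the tuples. An alternating elementary chain then
makes the two source models isomorphic, still matching the tuples (`SrcPair.exists_iso`). Elementary
extension preserves `Σ`, `T` and the truth values of `θ`, which contradicts implicit definability.

The translation is correct by induction on formulas (`realize_translate`): explicit definitions
settle the atoms, and the quantifiers are settled because `T` is total on `M` and onto `N`.
Injectivity of `T` is not needed, since identity has its own definition `ε`. -/

namespace FirstOrder.Language

/-! ### Compactness with free variables -/

section Compactness

variable {L : FirstOrder.Language.{u₁, v₁}} {α : Type w}

/-- Compactness for sets of formulas with free variables. -/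
theorem Formula.exists_realize_of_finite_subsets (Φ : Set (L.Formula α))
    (h : ∀ Φ₀ ⊆ Φ, Φ₀.Finite → ∃ (D : Type (max u₁ v₁ w)) (_ : Nonempty D) (_ : L.Structure D)
      (v : α → D), ∀ φ ∈ Φ₀, φ.Realize v) :
    ∃ (D : Type (max u₁ v₁ w)) (_ : Nonempty D) (_ : L.Structure D) (v : α → D),
      ∀ φ ∈ Φ, φ.Realize v := by
  have hsat : Theory.IsSatisfiable (Formula.equivSentence '' Φ : L[[α]].Theory) := by
    rw [Theory.isSatisfiable_iff_isFinitelySatisfiable]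
    intro T₀ hT₀
    obtain ⟨D, _, _, v, hv⟩ := h (Formula.equivSentence ⁻¹' (T₀ : Set L[[α]].Sentence))
      (fun φ hφ => by
        obtain ⟨ψ, hψ, h'⟩ := hT₀ hφ
        rwa [← Formula.equivSentence.injective h'])
      (T₀.finite_toSet.preimage Formula.equivSentence.injective.injOn)
    let := constantsOn.structure v
    have : D ⊨ (T₀ : L[[α]].Theory) := ⟨fun φ hφ => by
      rw [← Formula.equivSentence.apply_symm_apply φ, Formula.realize_equivSentence]
      exact hv _ (by simpa using hφ)⟩
    exact Theory.Model.isSatisfiable D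
  obtain ⟨D⟩ := hsat
  let : L.Structure D := (L.lhomWithConstants α).reduct D
  have : (L.lhomWithConstants α).IsExpansionOn D := LHom.isExpansionOn_reduct _ _
  exact ⟨D, inferInstance, inferInstance, fun a => (L.con a : D), fun φ hφ =>
    (Formula.realize_equivSentence D φ).1
      (Theory.realize_sentence_of_mem _ (Set.mem_image_of_mem _ hφ))⟩

end Compactness

/-! ### Transfer of formulas along equal types -/

section Extension

variable {L : FirstOrder.Language.{u₁, v₁}} {A X Y : Type*} [L.Structure X] [L.Structure Y]

/-- If the families `u` and `v` have the same type, then every formula with parameters that holds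
in `Y` holds in `X` for some substitution of its parameters that takes `v` to `u`. -/
theorem Formula.exists_realize_of_type_eq {u : A → X} {v : A → Y}
    (huv : ∀ φ : L.Formula A, φ.Realize u ↔ φ.Realize v) (ψ : L.Formula Y)
    (hψ : ψ.Realize id) : ∃ s : Y → X, ψ.Realize s ∧ ∀ a, s (v a) = u a := by
  classical
  -- Neither family need be injective; the equations in the common type make `u` factor through `v`.
  have hwd : ∀ a a', v a = v a' → u a = u a' := fun a a' h => by
    have := huv (Term.equal (Term.var a) (Term.var a'))
    simp only [Formula.realize_equal, Term.realize_var] at this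
    exact this.2 h
  -- `s` must be total on `Y`, so variables foreign to `ψ` need a default value in `X`; the type
  -- contains `∃ x, ⊤`.
  have hne : Nonempty Y → Nonempty X := fun hY => by
    have := huv (Formula.iExs (Fin 1) (⊤ : L.Formula (A ⊕ Fin 1)))
    simp only [Formula.realize_iExs, Formula.realize_top, exists_const_iff, and_true] at this
    exact (this.2 (hY.map fun y _ => y)).map fun f => f 0
  let F := ψ.freeVarFinset
  -- Parameters of the form `v a` become the variable `a`; the finitely many others are quantified
  -- existentially in `χ`, which then has variables in `A` only and transfers.
  let place : F → A ⊕ F := fun y =>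
    if h : ∃ a, v a = y then .inl h.choose else .inr y
  let χ : L.Formula A := Formula.iExs F (ψ.restrictFreeVar place)
  have hχ : χ.Realize v := by
    rw [Formula.realize_iExs]
    refine ⟨fun y => y, (BoundedFormula.realize_restrictFreeVar id fun y => ?_).2 hψ⟩
    by_cases h : ∃ a, v a = y
    · simp only [place, dif_pos h, Sum.elim_inl, id]
      exact h.choose_spec
    · simp only [place, dif_neg h, Sum.elim_inr, id]
  rw [← huv, Formula.realize_iExs] at hχ
  obtain ⟨t, ht⟩ := hχ
  let s : Y → X := fun y =>
    if h : ∃ a, v a = y then u h.choose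
    else if hy : y ∈ F then t ⟨y, hy⟩ else (hne ⟨y⟩).some
  refine ⟨s, (BoundedFormula.realize_restrictFreeVar s fun y => ?_).1 ht, fun a => ?_⟩
  · by_cases h : ∃ a, v a = y
    · simp only [place, s, dif_pos h, Sum.elim_inl]
    · simp only [place, s, dif_neg h, Sum.elim_inr]
      split_ifs with hy
      · rfl
      · exact absurd y.2 hy
  · have h : ∃ a', v a' = v a := ⟨a, rfl⟩
    simp only [s, dif_pos h]
    exact hwd _ _ h.choose_spec

/-- A map that preserves the truth of all formulas is an elementary embedding. -/
def ElementaryEmbedding.ofRealize (f : X → Y)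
    (hf : ∀ φ : L.Formula X, φ.Realize id → φ.Realize f) : X ↪ₑ[L] Y where
  toFun := f
  map_formula' n φ x := by
    have key : ∀ ψ : L.Formula (Fin n), ψ.Realize x → ψ.Realize (f ∘ x) := fun ψ h => by
      have := hf (ψ.relabel x) (by rwa [Formula.realize_relabel, Function.id_comp])
      rwa [Formula.realize_relabel] at this
    refine ⟨fun h => ?_, key φ⟩
    by_contra hn
    exact (Formula.realize_not.1 (key φ.not (Formula.realize_not.2 hn))) h

end Extension

/-! ### Unions of elementary chains -/

section Chain

variable {L : FirstOrder.Language.{u₁, v₁}} (G : ℕ → Type w) [∀ n, L.Structure (G n)]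
  (e : ∀ n, G n ↪ₑ[L] G (n + 1))

/-- The union of an elementary chain is an elementary extension of all its members. -/
theorem exists_elementary_chain_limit :
    ∃ (D : Type w) (_ : L.Structure D) (o : ∀ n, G n ↪ₑ[L] D),
      (∀ n x, o (n + 1) (e n x) = o n x) ∧ ∀ d, ∃ n x, o n x = d := by
  let f : ∀ n, G n ↪[L] G (n + 1) := fun n => (e n).toEmbedding
  let t := DirectedSystem.natLERec f
  have ht : ∀ m n (h : m ≤ n), ∃ g : G m ↪ₑ[L] G n, ⇑g = t m n h := by
    intro m n h
    induction n, h using Nat.le_induction with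
    | base => exact ⟨ElementaryEmbedding.refl L _, by
        ext x; simp [t, DirectedSystem.coe_natLERec, Nat.leRecOn_self]⟩
    | succ n h ih =>
      obtain ⟨g, hg⟩ := ih
      refine ⟨(e n).comp g, ?_⟩
      ext x
      simp only [ElementaryEmbedding.comp_apply, hg, t, DirectedSystem.coe_natLERec]
      rw [Nat.leRecOn_succ h]
      rfl
  let o : ∀ n, G n ↪[L] DirectLimit G t := DirectLimit.of L ℕ G t
  have ho : ∀ m n (h : m ≤ n) x, o n (t m n h x) = o m x := fun m n h x => DirectLimit.of_f
  have key : ∀ {α : Type} {n : ℕ} (φ : L.BoundedFormula α n) (k : ℕ) (v : α → G k)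
      (xs : Fin n → G k), φ.Realize (o k ∘ v) (o k ∘ xs) ↔ φ.Realize v xs := by
    intro α n φ
    induction φ with
    | falsum => intro k v xs; exact Iff.rfl
    | equal t₁ t₂ =>
      intro k v xs
      exact ((BoundedFormula.IsAtomic.equal t₁ t₂).isQF).realize_embedding (o k)
    | rel R ts =>
      intro k v xs
      exact ((BoundedFormula.IsAtomic.rel R ts).isQF).realize_embedding (o k)
    | imp φ ψ ih₁ ih₂ =>
      intro k v xs
      simp only [BoundedFormula.realize_imp, ih₁, ih₂]
    | all φ ih =>
      intro k v xs
      constructor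
      · intro h x
        have := h (o k x)
        rwa [← Fin.comp_snoc, ih] at this
      -- The Tarski argument: `d` appears at some stage `j`. Elementarity of the map from stage `k`
      -- to stage `max k j` carries the universal statement to a stage that contains `d`.
      · intro h d
        obtain ⟨j, y, rfl⟩ := DirectLimit.exists_of d
        change φ.Realize _ (Fin.snoc (o k ∘ xs) (o j y))
        obtain ⟨g, hg⟩ := ht k (max k j) (le_max_left _ _)
        have h' := (g.map_boundedFormula φ.all v xs).2 h (t j (max k j) (le_max_right _ _) y)
        rw [← ih, Fin.comp_snoc, ho, hg] at h'
        simpa only [Function.comp_def, ho] using h'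
  refine ⟨DirectLimit G t, inferInstance,
    fun n => ⟨o n, fun k φ x => ?_⟩, fun n x => ?_, fun d => DirectLimit.exists_of d⟩
  · have := key φ n x default
    rwa [Subsingleton.elim (o n ∘ default : Fin 0 → DirectLimit G t) default] at this
  · change o (n + 1) (e n x) = o n x
    rw [← ho n (n + 1) (Nat.le_succ n) x]
    simp [t, DirectedSystem.coe_natLERec, Nat.leRecOn_succ', f]

end Chain

end FirstOrder.Language

namespace CrossModel

open FirstOrder FirstOrder.Language

variable {L₁ : FirstOrder.Language.{u₁, v₁}} {L₂ : FirstOrder.Language.{u₂, v₂}}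

/-! ### Relativization to the source model -/

section Relativize

variable {D : Type w} {α : Type*}

theorem realize_incl₂_onTerm [L₂.IsRelational] (S : (sig L₁ L₂).Structure D) (t : L₂.Term α)
    (v : α → Src S) :
    (incl₂ (L₁ := L₁).onTerm t).realize (Subtype.val ∘ v) = (t.realize v).1 := by
  cases t with
  | var x => rfl
  | func f => exact isEmptyElim f

theorem comp_val_elim (S : (sig L₁ L₂).Structure D) {n : ℕ} (v : α → Src S) (xs : Fin n → Src S) :
    Sum.elim (Subtype.val ∘ v) (Subtype.val ∘ xs) = Subtype.val ∘ Sum.elim v xs :=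
  (Sum.comp_elim _ _ _).symm

theorem realize_srcSym (S : (sig L₁ L₂).Structure D) (t : (sig L₁ L₂).Term α) (v : α → D) :
    (srcSym.formula₁ t).Realize v ↔ t.realize v ∈ srcSet S := by
  simp only [Formula.realize_rel₁]
  rfl

/-- The meaning of a quantifier bounded by `M`. -/
theorem realize_all_imp_srcSym (S : (sig L₁ L₂).Structure D) {n : ℕ}
    (φ : (sig L₁ L₂).BoundedFormula α (n + 1)) (v : α → D) (xs : Fin n → D) :
    (BoundedFormula.all (.imp (srcSym.boundedFormula₁ (.var (.inr (Fin.last n)))) φ)).Realize v xs ↔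
      ∀ d : Src S, φ.Realize v (Fin.snoc xs d.1) := by
  have hmem : ∀ d : D, S.RelMap srcSym ![Term.realize (Sum.elim v
      (Fin.snoc xs d : Fin (n + 1) → D))
      (Term.var (.inr (Fin.last n)) : (sig L₁ L₂).Term (α ⊕ Fin (n + 1)))] ↔ d ∈ srcSet S := by
    intro d
    simp only [Term.realize_var, Sum.elim_inr, Fin.snoc_last]
    rfl
  simp only [BoundedFormula.realize_all, BoundedFormula.realize_imp, BoundedFormula.realize_rel₁,
    hmem]
  exact ⟨fun h d => h d.1 d.2, fun h d hd => h ⟨d, hd⟩⟩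

/-- The relativized formula says about `D` what the formula says about the source model. -/
theorem realize_relativize_bounded [L₂.IsRelational] (S : (sig L₁ L₂).Structure D) {n : ℕ}
    (φ : L₂.BoundedFormula α n) (v : α → Src S) (xs : Fin n → Src S) :
    (relativize (L₁ := L₁) φ).Realize (Subtype.val ∘ v) (Subtype.val ∘ xs) ↔ φ.Realize v xs := by
  induction φ with
  | falsum => exact Iff.rfl
  | equal t₁ t₂ =>
    simp only [relativize, BoundedFormula.Realize, comp_val_elim, realize_incl₂_onTerm,
      Subtype.ext_iff]
  | rel Q ts =>
    simp only [relativize, BoundedFormula.Realize, comp_val_elim, realize_incl₂_onTerm]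
    rfl
  | imp φ ψ ih₁ ih₂ =>
    simp only [relativize, BoundedFormula.realize_imp, ih₁, ih₂]
  | all φ ih =>
    rw [relativize, realize_all_imp_srcSym, BoundedFormula.realize_all]
    refine forall_congr' fun d => ?_
    rw [← ih, Fin.comp_snoc]

theorem realize_relativize [L₂.IsRelational] (S : (sig L₁ L₂).Structure D)
    (φ : L₂.Formula α) (v : α → Src S) :
    Formula.Realize (relativize (L₁ := L₁) φ) (Subtype.val ∘ v) ↔ φ.Realize v := by
  have := realize_relativize_bounded S φ v default
  rwa [Subsingleton.elim (Subtype.val ∘ default : Fin 0 → D) default] at this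

end Relativize

/-! ### Amalgamation over a common source type -/

section Amalgamation

variable {D E : Type (max u₁ v₁ u₂ v₂)}

/-- Elementary embeddings preserve and reflect the source domain. -/
theorem mem_srcSet_iff [S : (sig L₁ L₂).Structure D] [S' : (sig L₁ L₂).Structure E]
    (e : D ↪ₑ[sig L₁ L₂] E) (x : D) : e x ∈ srcSet S' ↔ x ∈ srcSet S := by
  have h := e.map_rel srcSym ![x]
  rwa [show e ∘ ![x] = ![e x] from List.ofFn_inj.1 rfl] at h

theorem mapsTo_iff [S : (sig L₁ L₂).Structure D] [S' : (sig L₁ L₂).Structure E]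
    (e : D ↪ₑ[sig L₁ L₂] E) (x y : D) : MapsTo S' (e x) (e y) ↔ MapsTo S x y := by
  have h := e.map_rel mapSym ![x, y]
  rwa [show e ∘ ![x, y] = ![e x, e y] from List.ofFn_inj.1 rfl] at h

/-- If families in two source models have the same type, then the first structure has an
elementary extension into whose source model the second source model embeds elementarily, in such
a way that the two families are identified. -/
theorem exists_amalgam [L₂.IsRelational] [Nonempty D] [S : (sig L₁ L₂).Structure D] [S' : (sig L₁ L₂).Structure E]
    {A : Type*} {u : A → Src S} {v : A → Src S'}
    (huv : ∀ φ : L₂.Formula A, φ.Realize u ↔ φ.Realize v) :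
    ∃ (F : Type (max u₁ v₁ u₂ v₂)) (_ : Nonempty F) (S'' : (sig L₁ L₂).Structure F)
      (e : D ↪ₑ[sig L₁ L₂] F) (g : Src S' ↪ₑ[L₂] Src S''), ∀ a, (g (v a)).1 = e (u a) := by
  let enc₁ : (sig L₁ L₂).Formula D → (sig L₁ L₂).Formula (D ⊕ Src S') := Formula.relabel Sum.inl
  let enc₂ : L₂.Formula (Src S') → (sig L₁ L₂).Formula (D ⊕ Src S') :=
    fun ψ => Formula.relabel Sum.inr (relativize (L₁ := L₁) ψ : (sig L₁ L₂).Formula (Src S'))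
  let enc₃ : Src S' → (sig L₁ L₂).Formula (D ⊕ Src S') := fun y =>
    srcSym.formula₁ (Term.var (.inr y))
  let enc₄ : A → (sig L₁ L₂).Formula (D ⊕ Src S') := fun a =>
    Term.equal (Term.var (.inl (u a).1)) (Term.var (.inr (v a)))
  let Φ₂ : Set (L₂.Formula (Src S')) := {ψ | ψ.Realize id}
  obtain ⟨F, hF, S'', val, hval⟩ := Formula.exists_realize_of_finite_subsets
    (enc₁ '' {φ | φ.Realize id} ∪ enc₂ '' Φ₂ ∪ Set.range enc₃ ∪ Set.range enc₄) (by
      intro Φ₀ hΦ₀ hfin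
      obtain ⟨Ψ, hΨ, hΨ'⟩ := Set.subset_image_iff.1
        (Set.inter_subset_right : Φ₀ ∩ enc₂ '' Φ₂ ⊆ enc₂ '' Φ₂)
      -- One preimage is chosen for each encoded formula, which avoids proving `enc₂` injective.
      obtain ⟨Ψ₀, hΨ₀, hΨfin, hΨ₀'⟩ : ∃ Ψ₀ ⊆ Φ₂, Ψ₀.Finite ∧ Φ₀ ∩ enc₂ '' Φ₂ ⊆ enc₂ '' Ψ₀ := by
        obtain ⟨Ψ₀, h₁, h₂⟩ := Set.exists_subset_bijOn Ψ enc₂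
        refine ⟨Ψ₀, h₁.trans hΨ, ?_, ?_⟩
        · exact h₂.finite_iff_finite.2 (hΨ' ▸ hfin.subset Set.inter_subset_left)
        · rw [← hΨ', h₂.image_eq]
      have := hΨfin.to_subtype
      -- Finite parts are satisfied in `D` itself: the conjunction of the finitely many facts about
      -- the second source model is realized in the first one, with `v` sent to `u`.
      obtain ⟨s, hs, hsu⟩ := Formula.exists_realize_of_type_eq huv
        (Formula.iInf fun ψ : Ψ₀ => ψ.1) (Formula.realize_iInf.2 fun ψ => hΨ₀ ψ.2)
      rw [Formula.realize_iInf] at hs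
      refine ⟨D, inferInstance, S, Sum.elim id (Subtype.val ∘ s), fun φ hφ => ?_⟩
      rcases hΦ₀ hφ with ((⟨χ, hχ, rfl⟩ | h₂) | ⟨y, rfl⟩) | ⟨a, rfl⟩
      · rwa [Formula.realize_relabel, Sum.elim_comp_inl]
      · obtain ⟨ψ, hψ, rfl⟩ := hΨ₀' ⟨hφ, h₂⟩
        rw [Formula.realize_relabel, Sum.elim_comp_inr, realize_relativize]
        exact hs ⟨ψ, hψ⟩
      · exact (realize_srcSym S _ _).2 (s y).2
      · simp only [enc₄, Formula.realize_equal, Term.realize_var, Sum.elim_inl, Sum.elim_inr, id,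
          Function.comp_apply, hsu])
  have hmem : ∀ y, val (.inr y) ∈ srcSet S'' := fun y =>
    (realize_srcSym S'' (Term.var (.inr y : D ⊕ Src S')) val).1 (hval _ (.inl (.inr ⟨y, rfl⟩)))
  refine ⟨F, hF, S'', ElementaryEmbedding.ofRealize (val ∘ Sum.inl) fun φ hφ => ?_,
    ElementaryEmbedding.ofRealize (fun y => ⟨val (.inr y), hmem y⟩) fun ψ hψ => ?_, fun a => ?_⟩
  · have := hval _ (.inl (.inl (.inl ⟨φ, hφ, rfl⟩)))
    rwa [Formula.realize_relabel] at this
  · have := hval _ (.inl (.inl (.inr ⟨ψ, hψ, rfl⟩)))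
    rw [Formula.realize_relabel] at this
    exact (realize_relativize S'' ψ _).1 this
  · have := hval _ (.inr ⟨a, rfl⟩)
    simp only [enc₄, Formula.realize_equal, Term.realize_var] at this
    exact this.symm

end Amalgamation

/-! ### Making source models isomorphic by an alternating chain -/

section Chain

/-- Two structures with an elementary embedding between their source models. -/
structure SrcPair (L₁ : FirstOrder.Language.{u₁, v₁}) (L₂ : FirstOrder.Language.{u₂, v₂})
    [L₂.IsRelational] where
  left : Type (max u₁ v₁ u₂ v₂)
  right : Type (max u₁ v₁ u₂ v₂)
  [leftNonempty : Nonempty left]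
  [rightNonempty : Nonempty right]
  [leftStr : (sig L₁ L₂).Structure left]
  [rightStr : (sig L₁ L₂).Structure right]
  emb : Src leftStr ↪ₑ[L₂] Src rightStr

attribute [instance] SrcPair.leftNonempty SrcPair.rightNonempty SrcPair.leftStr SrcPair.rightStr

variable [L₂.IsRelational]

/-- An elementary extension of a pair whose embedding covers the right-hand source model of the
given pair. -/
structure SrcPair.Extension (p : SrcPair L₁ L₂) where
  pair : SrcPair L₁ L₂
  left : p.left ↪ₑ[sig L₁ L₂] pair.left
  right : p.right ↪ₑ[sig L₁ L₂] pair.right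
  comm : ∀ (x : Src p.leftStr) (x' : Src pair.leftStr), x'.1 = left x.1 →
    (pair.emb x').1 = right (p.emb x).1
  cover : ∀ y : Src p.rightStr, ∃ x : Src pair.leftStr, (pair.emb x).1 = right y.1

/-- Two amalgamations, back and forth. The left side grows until the right source model embeds in it
by `g`, with `g ∘ p.emb` the left extension map. The right side then grows to receive the new left
source model by `f`, with `f ∘ g` the right extension map. Hence `g y` is the preimage that covers
`y`. -/
theorem SrcPair.nonempty_extension (p : SrcPair L₁ L₂) : Nonempty p.Extension := by
  obtain ⟨A, _, SA, eA, g, hg⟩ := exists_amalgam (u := id) (v := p.emb)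
    fun φ => (p.emb.map_formula φ id).symm
  obtain ⟨B, _, SB, eB, f, hf⟩ := exists_amalgam (u := id) (v := g)
    fun φ => (g.map_formula φ id).symm
  refine ⟨⟨⟨A, B, f⟩, eA, eB, fun x x' h => ?_, fun y => ⟨g y, hf y⟩⟩⟩
  have : x' = g (p.emb x) := Subtype.ext (h.trans (hg x).symm)
  rw [this]
  exact hf _

/-- The elementary chain of pairs that starts from a given pair. -/
noncomputable def SrcPair.chain (p : SrcPair L₁ L₂) : ℕ → SrcPair L₁ L₂
  | 0 => p
  | n + 1 => (p.chain n).nonempty_extension.some.pair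

/-- If the source model of one structure embeds elementarily into that of another one, then the
two structures have elementary extensions with isomorphic source models. -/
theorem SrcPair.exists_iso (p : SrcPair L₁ L₂) :
    ∃ (D E : Type (max u₁ v₁ u₂ v₂)) (_ : Nonempty D) (_ : Nonempty E)
      (S : (sig L₁ L₂).Structure D) (S' : (sig L₁ L₂).Structure E)
      (e : p.left ↪ₑ[sig L₁ L₂] D) (e' : p.right ↪ₑ[sig L₁ L₂] E) (Z : Src S ≃[L₂] Src S'),
      ∀ (x : Src p.leftStr) (x' : Src S), x'.1 = e x.1 → (Z x').1 = e' (p.emb x).1 := by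
  let c := p.chain
  let ext : ∀ n, (c n).Extension := fun n => (c n).nonempty_extension.some
  let l : ∀ n, (c n).left ↪ₑ[sig L₁ L₂] (c (n + 1)).left := fun n => (ext n).left
  let r : ∀ n, (c n).right ↪ₑ[sig L₁ L₂] (c (n + 1)).right := fun n => (ext n).right
  have hcomm : ∀ n (x : Src (c n).leftStr) (x' : Src (c (n + 1)).leftStr), x'.1 = l n x.1 →
      ((c (n + 1)).emb x').1 = r n ((c n).emb x).1 := fun n => (ext n).comm
  have hcover : ∀ n (y : Src (c n).rightStr), ∃ x : Src (c (n + 1)).leftStr,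
      ((c (n + 1)).emb x).1 = r n y.1 := fun n => (ext n).cover
  obtain ⟨D, S, o, ho, hoD⟩ := exists_elementary_chain_limit (fun n => (c n).left) l
  obtain ⟨E, S', o', ho', hoE⟩ := exists_elementary_chain_limit (fun n => (c n).right) r
  have lift : ∀ n m, n ≤ m → ∀ x : Src (c n).leftStr, ∃ x' : Src (c m).leftStr,
      o m x'.1 = o n x.1 ∧ o' m ((c m).emb x').1 = o' n ((c n).emb x).1 := by
    intro n m h x
    induction m, h using Nat.le_induction with
    | base => exact ⟨x, rfl, rfl⟩
    | succ m h ih =>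
      obtain ⟨x', h₁, h₂⟩ := ih
      refine ⟨⟨l m x'.1, (mem_srcSet_iff (l m) _).2 x'.2⟩, ?_, ?_⟩
      · rw [ho, h₁]
      · rw [hcomm m x' _ rfl, ho', h₂]
  -- The union of the graphs of the stage embeddings; the isomorphism `Z` will have this graph.
  let R : Src S → Src S' → Prop := fun d d' =>
    ∃ n, ∃ x : Src (c n).leftStr, o n x.1 = d.1 ∧ o' n ((c n).emb x).1 = d'.1
  have common : ∀ {k : ℕ} (ds : Fin k → Src S) (ds' : Fin k → Src S'), (∀ i, R (ds i) (ds' i)) →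
      ∃ m, ∃ xs : Fin k → Src (c m).leftStr,
        ∀ i, o m (xs i).1 = (ds i).1 ∧ o' m ((c m).emb (xs i)).1 = (ds' i).1 := by
    intro k ds ds' hR
    choose n x hx hx' using hR
    choose xs h₁ h₂ using fun i =>
      lift (n i) (Finset.univ.sup n) (Finset.le_sup (Finset.mem_univ i)) (x i)
    exact ⟨_, xs, fun i => ⟨(h₁ i).trans (hx i), (h₂ i).trans (hx' i)⟩⟩
  have total : ∀ d, ∃ d', R d d' := by
    rintro ⟨d, hd⟩
    obtain ⟨n, x, rfl⟩ := hoD d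
    have hx := (mem_srcSet_iff (o n) x).1 hd
    exact ⟨⟨_, (mem_srcSet_iff (o' n) _).2 ((c n).emb ⟨x, hx⟩).2⟩, n, ⟨x, hx⟩, rfl, rfl⟩
  have surj : ∀ d', ∃ d, R d d' := by
    rintro ⟨d', hd'⟩
    obtain ⟨n, y, rfl⟩ := hoE d'
    have hy := (mem_srcSet_iff (o' n) y).1 hd'
    -- A right-hand element of stage `n` acquires its preimage only at stage `n + 1`.
    obtain ⟨x, hx⟩ := hcover n ⟨y, hy⟩
    exact ⟨⟨_, (mem_srcSet_iff (o (n + 1)) _).2 x.2⟩, n + 1, x, rfl, by rw [hx, ho']⟩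
  -- Two related pairs live at a common stage, where the embedding is an injective function. So `R`
  -- is both functional and injective.
  have unique : ∀ {d₁ d₁' d₂ d₂'}, R d₁ d₁' → R d₂ d₂' → (d₁ = d₂ ↔ d₁' = d₂') := by
    intro d₁ d₁' d₂ d₂' h₁ h₂
    obtain ⟨m, xs, hxs⟩ := common ![d₁, d₂] ![d₁', d₂'] (Fin.forall_fin_two.2 ⟨h₁, h₂⟩)
    obtain ⟨⟨ha, ha'⟩, hb, hb'⟩ := Fin.forall_fin_two.1 hxs
    rw [Subtype.ext_iff, Subtype.ext_iff]
    have e₁ : d₁.1 = o m (xs 0).1 := ha.symm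
    have e₂ : d₂.1 = o m (xs 1).1 := hb.symm
    have e₁' : d₁'.1 = o' m ((c m).emb (xs 0)).1 := ha'.symm
    have e₂' : d₂'.1 = o' m ((c m).emb (xs 1)).1 := hb'.symm
    rw [e₁, e₂, e₁', e₂', (o m).injective.eq_iff, (o' m).injective.eq_iff, ← Subtype.ext_iff,
      ← Subtype.ext_iff, (c m).emb.injective.eq_iff]
  choose z hz using total
  let Z : Src S ≃[L₂] Src S' :=
    { Equiv.ofBijective z ⟨fun d₁ d₂ h => (unique (hz d₁) (hz d₂)).2 h, fun d' => by
        obtain ⟨d, hd⟩ := surj d'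
        exact ⟨d, (unique (hz d) hd).1 rfl⟩⟩ with
      map_fun' := fun f => isEmptyElim f
      map_rel' := fun {k} Q ds => by
        obtain ⟨m, xs, hxs⟩ := common ds (z ∘ ds) fun i => hz (ds i)
        have h₁ : S.RelMap (sym₂ Q) (fun i => (ds i).1) ↔
            (c m).leftStr.RelMap (sym₂ Q) (fun i => (xs i).1) := by
          rw [← (o m).map_rel]
          simp only [Function.comp_def, (hxs _).1]
        have h₂ : S'.RelMap (sym₂ Q) (fun i => (z (ds i)).1) ↔
            (c m).rightStr.RelMap (sym₂ Q) (fun i => ((c m).emb (xs i)).1) := by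
          rw [← (o' m).map_rel]
          simp only [Function.comp_def, (hxs _).2]
        exact h₂.trans (((c m).emb.map_rel Q xs).trans h₁.symm) }
  refine ⟨D, E, p.leftNonempty.map (o 0), p.rightNonempty.map (o' 0), S, S', o 0, o' 0, Z,
    fun x x' h => ?_⟩
  have hR : R x' ⟨o' 0 (p.emb x).1, (mem_srcSet_iff (o' 0) _).2 (p.emb x).2⟩ := ⟨0, x, h.symm, rfl⟩
  exact Subtype.ext_iff.1 ((unique (hz x') hR).1 rfl)

end Chain

/-! ### Moving a structure into a larger domain -/

section Push

variable [L₁.IsRelational] [L₂.IsRelational] {D E : Type w}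

/-- The image of a relational structure under a map into a possibly larger domain. -/
@[reducible] def push (S : (sig L₁ L₂).Structure D) (ι : D → E) : (sig L₁ L₂).Structure E where
  funMap := fun f _ => isEmptyElim f
  RelMap := fun R xs => ∃ ys, xs = ι ∘ ys ∧ S.RelMap R ys

variable (S : (sig L₁ L₂).Structure D) {ι : D → E}

theorem push_relMap (hι : Function.Injective ι) {n : ℕ} (R : (sig L₁ L₂).Relations n) (ys : Fin n → D) :
    (push S ι).RelMap R (ι ∘ ys) ↔ S.RelMap R ys := by
  constructor
  · rintro ⟨zs, h, hz⟩
    rwa [hι.comp_left h]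
  · exact fun h => ⟨ys, rfl, h⟩

theorem srcSet_push : srcSet (push S ι) = ι '' srcSet S := by
  ext x
  constructor
  · rintro ⟨ys, h, hy⟩
    refine ⟨ys 0, ?_, (congrFun h 0).symm⟩
    rwa [show ys = ![ys 0] from List.ofFn_inj.1 rfl] at hy
  · rintro ⟨y, hy, rfl⟩
    exact ⟨![y], List.ofFn_inj.1 rfl, hy⟩

theorem tgtSet_push : tgtSet (push S ι) = ι '' tgtSet S := by
  ext x
  constructor
  · rintro ⟨ys, h, hy⟩
    refine ⟨ys 0, ?_, (congrFun h 0).symm⟩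
    rwa [show ys = ![ys 0] from List.ofFn_inj.1 rfl] at hy
  · rintro ⟨y, hy, rfl⟩
    exact ⟨![y], List.ofFn_inj.1 rfl, hy⟩

theorem mapsTo_push {x y : D} (h : MapsTo S x y) : MapsTo (push S ι) (ι x) (ι y) :=
  ⟨![x, y], List.ofFn_inj.1 rfl, h⟩

theorem Bookkeeping.push (hι : Function.Injective ι) (h : Bookkeeping S) : Bookkeeping (push S ι) where
  disjoint := by
    rw [srcSet_push, tgtSet_push]
    exact (Set.disjoint_image_iff hι).2 h.disjoint
  rel₁ := by
    rintro n P _ ⟨ys, rfl, hy⟩ i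
    rw [tgtSet_push]
    exact ⟨_, h.rel₁ n P ys hy i, rfl⟩
  rel₂ := by
    rintro n Q _ ⟨ys, rfl, hy⟩ i
    rw [srcSet_push]
    exact ⟨_, h.rel₂ n Q ys hy i, rfl⟩
  map := by
    rintro x y ⟨ys, hxy, hy⟩
    rw [srcSet_push, tgtSet_push]
    rw [show ys = ![ys 0, ys 1] from List.ofFn_inj.1 rfl] at hy
    have := h.map _ _ hy
    exact ⟨⟨_, this.1, (congrFun hxy 0).symm⟩, ⟨_, this.2, (congrFun hxy 1).symm⟩⟩

/-- An injective `ι` restricts to an isomorphism between the two copies of `M ∪ N`, and isomorphic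
structures satisfy the same theory. -/
theorem sat_restrict_push_iff (hι : Function.Injective ι) (Th : (sig L₁ L₂).Theory) :
    Sat (restrict (push S ι) (srcSet (push S ι) ∪ tgtSet (push S ι))) Th ↔
      Sat (restrict S (srcSet S ∪ tgtSet S)) Th := by
  have hset : srcSet (push S ι) ∪ tgtSet (push S ι) = ι '' (srcSet S ∪ tgtSet S) := by
    rw [srcSet_push, tgtSet_push, Set.image_union]
  rw [hset]
  let T := restrict S (srcSet S ∪ tgtSet S)
  let T' := restrict (push S ι) (ι '' (srcSet S ∪ tgtSet S))
  let f : (srcSet S ∪ tgtSet S : Set D) ≃[sig L₁ L₂] (ι '' (srcSet S ∪ tgtSet S) : Set E) :=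
    { Equiv.Set.image ι (srcSet S ∪ tgtSet S) hι with
      map_fun' := fun g => isEmptyElim g
      map_rel' := fun R xs => push_relMap S hι R (fun i => (xs i).1) }
  exact (f.toElementaryEmbedding.theory_model_iff Th).symm

/-- The source model does not change when the structure is moved into a larger domain. -/
noncomputable def srcPushEquiv (hι : Function.Injective ι) : Src S ≃[L₂] Src (push S ι) where
  toEquiv := (Equiv.Set.image ι (srcSet S) hι).trans (Equiv.setCongr (srcSet_push S).symm)
  map_fun' := fun f => isEmptyElim f
  map_rel' := fun Q xs => push_relMap S hι (sym₂ Q) (fun i => (xs i).1)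

/-- The inclusion of the target domain into the target domain of the moved structure. -/
def tgtPush (ι : D → E) (y : Tgt S) : Tgt (push S ι) :=
  ⟨ι y.1, by rw [tgtSet_push]; exact ⟨_, y.2, rfl⟩⟩

end Push

/-! ### Implicit definability across different domains -/

section Implicit

variable [L₁.IsRelational] [L₂.IsRelational] {D E : Type (max u₁ v₁ u₂ v₂)}
  {Th : (sig L₁ L₂).Theory}

/-- Locality of `Σ` does the work: points outside the image of `ι` lie outside `M ∪ N`, so applying
`local_iff` to both structures reduces the claim to their isomorphic restrictions. -/
theorem DefinesTransformation.sat_push (hTh : DefinesTransformation Th) [Nonempty D]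
    {S : (sig L₁ L₂).Structure D} {ι : D → E} (hι : Function.Injective ι) (h : Sat S Th) :
    Sat (push S ι) Th := by
  have hb := hTh.bookkeeping D S h
  have : Nonempty E := ‹Nonempty D›.map ι
  rw [hTh.local_iff E _ (Bookkeeping.push S hι hb), sat_restrict_push_iff S hι, ← hTh.local_iff D S hb]
  exact h

/-- Implicit definability across models extends to models with different domains. -/
theorem Implicit.of_distinct_domains (hTh : DefinesTransformation Th) {n : ℕ}
    {R : ∀ {D : Type (max u₁ v₁ u₂ v₂)} (S : (sig L₁ L₂).Structure D), (Fin n → Tgt S) → Prop}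
    (hR : ∀ {D E : Type (max u₁ v₁ u₂ v₂)} (S : (sig L₁ L₂).Structure D) (ι : D → E),
      Function.Injective ι → ∀ a, R (push S ι) (tgtPush S ι ∘ a) ↔ R S a)
    (hI : Implicit Th R) [Nonempty D] [Nonempty E] {S : (sig L₁ L₂).Structure D}
    {S' : (sig L₁ L₂).Structure E} (hS : Sat S Th) (hS' : Sat S' Th) (Z : Src S ≃[L₂] Src S')
    {b : Fin n → Src S} {a : Fin n → Tgt S} {a' : Fin n → Tgt S'}
    (hba : ∀ i, MapsTo S (b i).1 (a i).1) (hba' : ∀ i, MapsTo S' (Z (b i)).1 (a' i).1)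
    (h : R S a) : R S' a' := by
  have hl : Function.Injective (Sum.inl : D → D ⊕ E) := Sum.inl_injective
  have hr : Function.Injective (Sum.inr : E → D ⊕ E) := Sum.inr_injective
  rw [← hR S' _ hr]
  rw [← hR S _ hl] at h
  refine hI (D ⊕ E) _ _ (hTh.sat_push hl hS) (hTh.sat_push hr hS')
    -- On the common domain `D ⊕ E`, the isomorphism is `Z` conjugated by the two inclusions.
    ((srcPushEquiv S' hr).comp (Z.comp (srcPushEquiv S hl).symm)) (srcPushEquiv S hl ∘ b) _
    (fun i => srcPushEquiv S' hr (Z (b i))) _ (fun i => mapsTo_push S (hba i)) (fun i => ?_)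
    (fun i => mapsTo_push S' (hba' i)) h
  simp

end Implicit

/-! ### Explicit definitions from compactness -/

section Definition

variable [L₁.IsRelational] [L₂.IsRelational] {Th : (sig L₁ L₂).Theory} {n : ℕ}

/-- Compactness for the source models of models of a theory. -/
theorem DefinesTransformation.exists_realize (hTh : DefinesTransformation Th)
    (χ : (sig L₁ L₂).Formula (Fin n)) (Γ : Set (L₂.Formula (Fin n)))
    (h : ∀ Γ₀ ⊆ Γ, Γ₀.Finite → ∃ (D : Type (max u₁ v₁ u₂ v₂)) (_ : Nonempty D)
      (S : (sig L₁ L₂).Structure D) (x : Fin n → Src S) (y : Fin n → D), Sat S Th ∧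
      (∀ i, MapsTo S (x i).1 (y i)) ∧ χ.Realize y ∧ ∀ γ ∈ Γ₀, γ.Realize x) :
    ∃ (D : Type (max u₁ v₁ u₂ v₂)) (_ : Nonempty D)
      (S : (sig L₁ L₂).Structure D) (x : Fin n → Src S) (y : Fin n → D), Sat S Th ∧
      (∀ i, MapsTo S (x i).1 (y i)) ∧ χ.Realize y ∧ ∀ γ ∈ Γ, γ.Realize x := by
  let encT : (sig L₁ L₂).Sentence → (sig L₁ L₂).Formula (Fin n ⊕ Fin n) :=
    fun φ => Formula.relabel Empty.elim φ
  let encM : Fin n → (sig L₁ L₂).Formula (Fin n ⊕ Fin n) := fun i =>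
    mapSym.formula₂ (Term.var (.inl i)) (Term.var (.inr i))
  let encΓ : L₂.Formula (Fin n) → (sig L₁ L₂).Formula (Fin n ⊕ Fin n) :=
    fun γ => Formula.relabel Sum.inl (relativize (L₁ := L₁) γ : (sig L₁ L₂).Formula (Fin n))
  have hencT : ∀ {D : Type (max u₁ v₁ u₂ v₂)} (S : (sig L₁ L₂).Structure D)
      (v : Fin n ⊕ Fin n → D) (φ : (sig L₁ L₂).Sentence),
      (encT φ).Realize v ↔ Sentence.Realize D φ := by
    intro D S v φ
    rw [Formula.realize_relabel, Sentence.Realize, Subsingleton.elim (v ∘ Empty.elim) default]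
  have hencM : ∀ {D : Type (max u₁ v₁ u₂ v₂)} (S : (sig L₁ L₂).Structure D)
      (v : Fin n ⊕ Fin n → D) (i : Fin n),
      (encM i).Realize v ↔ MapsTo S (v (.inl i)) (v (.inr i)) := by
    intro D S v i
    simp only [encM, Formula.realize_rel₂]
    rfl
  obtain ⟨D, hD, S, v, hv⟩ := Formula.exists_realize_of_finite_subsets
    (encT '' Th ∪ Set.range encM ∪ {Formula.relabel Sum.inr χ} ∪ encΓ '' Γ) (by
      intro Φ₀ hΦ₀ hfin
      obtain ⟨Γ₁, hΓ₁, hΓ₁'⟩ := Set.subset_image_iff.1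
        (Set.inter_subset_right : Φ₀ ∩ encΓ '' Γ ⊆ encΓ '' Γ)
      obtain ⟨Γ₀, h₁, h₂⟩ := Set.exists_subset_bijOn Γ₁ encΓ
      obtain ⟨D, hD, S, x, y, hS, hxy, hχ, hΓ⟩ := h Γ₀ (h₁.trans hΓ₁)
        (h₂.finite_iff_finite.2 (hΓ₁' ▸ hfin.subset Set.inter_subset_left))
      refine ⟨D, hD, S, Sum.elim (Subtype.val ∘ x) y, fun φ hφ => ?_⟩
      rcases hΦ₀ hφ with ((⟨χ, hχ, rfl⟩ | ⟨i, rfl⟩) | rfl) | h₃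
      · exact (hencT S _ _).2 (hS.realize_of_mem _ hχ)
      · exact (hencM S _ _).2 (hxy i)
      · rwa [Formula.realize_relabel, Sum.elim_comp_inr]
      · obtain ⟨γ, hγ, rfl⟩ : φ ∈ encΓ '' Γ₀ := by
          rw [h₂.image_eq, hΓ₁']
          exact ⟨hφ, h₃⟩
        rw [Formula.realize_relabel, Sum.elim_comp_inl, realize_relativize]
        exact hΓ γ hγ)
  have hS : Sat S Th := ⟨fun φ hφ => (hencT S v φ).1 (hv _ (.inl (.inl (.inl ⟨φ, hφ, rfl⟩))))⟩
  have hM : ∀ i, MapsTo S (v (.inl i)) (v (.inr i)) := fun i =>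
    (hencM S v i).1 (hv _ (.inl (.inl (.inr ⟨i, rfl⟩))))
  -- Nothing in the formula set puts the `x`-variables in `M`; this follows from `T ⊆ M × N`.
  refine ⟨D, hD, S, fun i => ⟨v (.inl i), ((hTh.bookkeeping D S hS).map _ _ (hM i)).1⟩,
    v ∘ Sum.inr, hS, hM, ?_, fun γ hγ => ?_⟩
  · have := hv _ (.inl (.inr rfl))
    rwa [Formula.realize_relabel] at this
  · have := hv _ (.inr ⟨γ, hγ, rfl⟩)
    rw [Formula.realize_relabel] at this
    exact (realize_relativize S γ _).1 this

/-- A formula about the target model that is preserved by isomorphisms of the source models is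
equivalent to a formula about the source model. -/
theorem DefinesTransformation.exists_definition (hTh : DefinesTransformation Th)
    (θ : (sig L₁ L₂).Formula (Fin n))
    (h : ∀ (D E : Type (max u₁ v₁ u₂ v₂)) [Nonempty D] [Nonempty E]
      (S : (sig L₁ L₂).Structure D) (S' : (sig L₁ L₂).Structure E), Sat S Th → Sat S' Th →
      ∀ (Z : Src S ≃[L₂] Src S') (b : Fin n → Src S) (a : Fin n → D) (a' : Fin n → E),
        (∀ i, MapsTo S (b i).1 (a i)) → (∀ i, MapsTo S' (Z (b i)).1 (a' i)) →
        θ.Realize a → θ.Realize a') :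
    ∃ δ : L₂.Formula (Fin n), ∀ (D : Type (max u₁ v₁ u₂ v₂)) [Nonempty D]
      (S : (sig L₁ L₂).Structure D), Sat S Th → ∀ (x : Fin n → Src S) (y : Fin n → D),
        (∀ i, MapsTo S (x i).1 (y i)) → (θ.Realize y ↔ δ.Realize x) := by
  by_contra! hδ
  -- `Γ` collects the source consequences of `θ`. No finite conjunction from `Γ` implies `θ`, as it
  -- would define `θ`; hence `Γ` is consistent with the negation of `θ`.
  let Γ : Set (L₂.Formula (Fin n)) := {γ | ∀ (D : Type (max u₁ v₁ u₂ v₂)) [Nonempty D]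
    (S : (sig L₁ L₂).Structure D), Sat S Th → ∀ (x : Fin n → Src S) (y : Fin n → D),
      (∀ i, MapsTo S (x i).1 (y i)) → θ.Realize y → γ.Realize x}
  obtain ⟨D₁, _, S₁, x₁, y₁, hS₁, hxy₁, hθ₁, hΓ₁⟩ := hTh.exists_realize θ.not Γ (by
    intro Γ₀ hΓ₀ hfin
    have := hfin.to_subtype
    obtain ⟨D, hD, S, hS, x, y, hxy, hne⟩ := hδ (Formula.iInf fun γ : Γ₀ => γ.1)
    refine ⟨D, hD, S, x, y, hS, hxy, ?_⟩
    rw [Formula.realize_iInf] at hne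
    rcases hne with ⟨hθ, hn⟩ | ⟨hθ, hγ⟩
    · obtain ⟨γ, hγ⟩ := not_forall.1 hn
      exact absurd (hΓ₀ γ.2 D S hS x y hxy hθ) hγ
    · exact ⟨Formula.realize_not.2 hθ, fun γ hγ' => hγ ⟨γ, hγ'⟩⟩)
  obtain ⟨D₀, _, S₀, x₀, y₀, hS₀, hxy₀, hθ₀, hΓ₀⟩ :=
      hTh.exists_realize θ {γ | γ.Realize x₁} (by
    intro Γ₀ hΓ₀ hfin
    have := hfin.to_subtype
    by_contra! hno
    -- If finitely many formulas of the type of `x₁` excluded `θ`, the negation of their conjunction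
    -- would lie in `Γ` and hence hold at `x₁`.
    have hmem : (Formula.iInf fun γ : Γ₀ => γ.1).not ∈ Γ := by
      intro D hD S hS x y hxy hθ
      obtain ⟨γ, hγ, hγx⟩ := hno D hD S x y hS hxy hθ
      rw [Formula.realize_not, Formula.realize_iInf]
      exact fun hall => hγx (hall ⟨γ, hγ⟩)
    have := hΓ₁ _ hmem
    rw [Formula.realize_not, Formula.realize_iInf] at this
    exact this fun γ => hΓ₀ γ.2)
  have htype : ∀ φ : L₂.Formula (Fin n), φ.Realize x₁ ↔ φ.Realize x₀ := fun φ => by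
    refine ⟨hΓ₀ φ, fun hφ => ?_⟩
    by_contra hn
    exact Formula.realize_not.1 (hΓ₀ φ.not (Formula.realize_not.2 hn)) hφ
  -- The model `D₁`, where `θ` fails, is extended to receive the source model of `D₀`, with `x₀`
  -- identified with `x₁`.
  obtain ⟨F, _, SF, e, g, hg⟩ := exists_amalgam htype
  obtain ⟨D, E, _, _, S, S', eD, eE, Z, hZ⟩ := SrcPair.exists_iso ⟨D₀, F, g⟩
  have hS : Sat S Th := (eD.theory_model_iff Th).1 hS₀
  have hS' : Sat S' Th := (eE.theory_model_iff Th).1 ((e.theory_model_iff Th).1 hS₁)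
  have hθ := h D E S S' hS hS' Z (fun i => ⟨eD (x₀ i).1, (mem_srcSet_iff eD _).2 (x₀ i).2⟩)
    (eD ∘ y₀) (eE ∘ e ∘ y₁) (fun i => (mapsTo_iff eD _ _).2 (hxy₀ i))
    (fun i => by
      rw [hZ (x₀ i) _ rfl]
      change MapsTo S' (eE (g (x₀ i)).1) (eE (e (y₁ i)))
      rw [hg, mapsTo_iff eE, mapsTo_iff e]
      exact hxy₁ i)
    ((eD.map_formula θ y₀).2 hθ₀)
  have h₁ : θ.Realize y₁ := (e.map_formula θ y₁).1 ((eE.map_formula θ (e ∘ y₁)).1 hθ)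
  exact Formula.realize_not.1 hθ₁ h₁

end Definition

/-! ### Relativized formulas with variables outside the source -/

section Relabel

variable {D : Type w} {α β : Type*} [L₂.IsRelational] (S : (sig L₁ L₂).Structure D)

theorem realize_incl₂_onTerm_relabel (t : L₂.Term β) (f : β → α) (v : α → D) (u : β → Src S)
    (h : v ∘ f = Subtype.val ∘ u) :
    (incl₂ (L₁ := L₁).onTerm (t.relabel f)).realize v = (t.realize u).1 := by
  cases t with
  | var x => exact congrFun h x
  | func f => exact isEmptyElim f

/-- The relativization of a relabelled formula only depends on the values of the variables in the
range of the relabelling. -/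
theorem realize_relativize_relabel_bounded {m k : ℕ} (g : β → α ⊕ Fin m)
    (φ : L₂.BoundedFormula β k) (v : α → D) (u : β → Src S) (xs : Fin (m + k) → Src S)
    (h : Sum.elim v (Subtype.val ∘ xs ∘ Fin.castAdd k) ∘ g = Subtype.val ∘ u) :
    (relativize (L₁ := L₁) (φ.relabel g)).Realize v (Subtype.val ∘ xs) ↔
      φ.Realize u (xs ∘ Fin.natAdd m) := by
  have haux : ∀ {k : ℕ} (xs : Fin (m + k) → Src S),
      Sum.elim v (Subtype.val ∘ xs ∘ Fin.castAdd k) ∘ g = Subtype.val ∘ u →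
      Sum.elim v (Subtype.val ∘ xs) ∘ BoundedFormula.relabelAux g k =
        Subtype.val ∘ Sum.elim u (xs ∘ Fin.natAdd m) := by
    intro k xs h
    rw [BoundedFormula.sumElim_comp_relabelAux, Sum.comp_elim, ← h]
    rfl
  induction φ with
  | falsum => exact Iff.rfl
  | equal t₁ t₂ =>
    refine Iff.trans ?_ Subtype.ext_iff.symm
    exact iff_of_eq (congrArg₂ (· = ·) (realize_incl₂_onTerm_relabel S t₁ _ _ _ (haux xs h))
      (realize_incl₂_onTerm_relabel S t₂ _ _ _ (haux xs h)))
  | rel Q ts =>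
    refine iff_of_eq (congrArg (S.RelMap (sym₂ Q)) (funext fun i => ?_))
    exact realize_incl₂_onTerm_relabel S (ts i) _ _ _ (haux xs h)
  | imp φ ψ ih₁ ih₂ =>
    rw [BoundedFormula.relabel_imp, relativize, BoundedFormula.realize_imp,
      BoundedFormula.realize_imp]
    exact imp_congr (ih₁ xs h) (ih₂ xs h)
  | @all k φ ih =>
    have hcast : ∀ {j : ℕ} (zs : Fin j → Src S) (d : Src S) (i : Fin j),
        (Fin.snoc zs d : Fin (j + 1) → Src S) i.castSucc = zs i :=
      fun zs d i => Fin.snoc_castSucc (α := fun _ => Src S) d zs i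
    have hlast : ∀ {j : ℕ} (zs : Fin j → Src S) (d : Src S),
        (Fin.snoc zs d : Fin (j + 1) → Src S) (Fin.last j) = d := fun zs d => Fin.snoc_last (α := fun _ => Src S) d zs
    have hsnoc : ∀ d, Sum.elim v (Subtype.val ∘
        (Fin.snoc xs d : Fin (m + k + 1) → Src S) ∘ Fin.castAdd (k + 1)) ∘ g =
          Subtype.val ∘ u := by
      intro d
      rw [← h]
      congr 2
      funext i
      exact congrArg Subtype.val (hcast xs d (Fin.castAdd k i))
    have hnat : ∀ d : Src S, (Fin.snoc xs d : Fin (m + k + 1) → Src S) ∘ Fin.natAdd m =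
        (Fin.snoc (xs ∘ Fin.natAdd m) d : Fin (k + 1) → Src S) := by
      intro d
      funext i
      refine Fin.lastCases ?_ (fun j => ?_) i
      · exact (hlast xs d).trans (hlast (xs ∘ Fin.natAdd m) d).symm
      · exact (hcast xs d (Fin.natAdd m j)).trans (hcast (xs ∘ Fin.natAdd m) d j).symm
    rw [BoundedFormula.relabel_all, relativize,
      realize_all_imp_srcSym, BoundedFormula.realize_all]
    refine forall_congr' fun d => ?_
    rw [← Fin.comp_snoc, ← hnat]
    exact ih (Fin.snoc xs d) (hsnoc d)

/-- Needed because in an explicit definition the assignment also covers the variables `yᵢ`, which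
take values in `N`; `realize_relativize` requires all values in `M`. -/
theorem realize_relativize_relabel (g : β → α) (φ : L₂.Formula β) (v : α → D) (u : β → Src S)
    (h : v ∘ g = Subtype.val ∘ u) :
    Formula.Realize (relativize (L₁ := L₁) (Formula.relabel g φ)) v ↔ φ.Realize u := by
  have := realize_relativize_relabel_bounded S (m := 0) (Sum.inl ∘ g) φ v u
    (fun i : Fin 0 => i.elim0) h
  rw [Subsingleton.elim (Subtype.val ∘ fun i : Fin 0 => i.elim0 : Fin 0 → D) default,
    Subsingleton.elim ((fun i : Fin 0 => i.elim0) ∘ Fin.natAdd 0 : Fin 0 → Src S) default] at this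
  exact this

end Relabel

/-! ### From semantic to syntactic definitions -/

section Explicit

theorem realize_matching {D : Type w} (S : (sig L₁ L₂).Structure D) {n : ℕ}
    (v : Fin n ⊕ Fin n → D) (xs : Fin 0 → D) :
    BoundedFormula.Realize (matching L₁ L₂ n) v xs ↔ ∀ i, MapsTo S (v (.inl i)) (v (.inr i)) := by
  rw [matching, BoundedFormula.realize_iInf]
  refine forall_congr' fun i => ?_
  rw [Subsingleton.elim xs default]
  exact Formula.realize_rel₂

variable [L₂.IsRelational] {Th : (sig L₁ L₂).Theory}

/-- The explicit definition of identity in a model of the theory. -/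
theorem ExplicitlyDefinesIdentity.eq_iff {ε : L₂.Formula (Fin 2)}
    (h : ExplicitlyDefinesIdentity Th ε) {D : Type (max u₁ v₁ u₂ v₂)} [Nonempty D]
    {S : (sig L₁ L₂).Structure D} (hS : Sat S Th) (x : Fin 2 → Src S) (y : Fin 2 → Tgt S)
    (hxy : ∀ i, MapsTo S (x i).1 (y i).1) : y 0 = y 1 ↔ ε.Realize x := by
  have : D ⊨ Th := hS
  have := h.realize_boundedFormula D
    (v := Sum.elim (Subtype.val ∘ x) (Subtype.val ∘ y)) (xs := default)
  rw [BoundedFormula.realize_imp, realize_matching, BoundedFormula.realize_iff] at this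
  refine Iff.trans ?_ ((this hxy).trans (realize_relativize_relabel S Sum.inl ε _ x rfl))
  exact Subtype.ext_iff

variable [L₁.IsRelational]

/-- A semantic criterion for explicit definitions. -/
theorem DefinesTransformation.models_definition (hTh : DefinesTransformation Th) {n : ℕ}
    {θ : (sig L₁ L₂).Formula (Fin n ⊕ Fin n)} {δ : L₂.Formula (Fin n)}
    (h : ∀ (D : Type (max u₁ v₁ u₂ v₂)) [Nonempty D] (S : (sig L₁ L₂).Structure D), Sat S Th →
      ∀ (x : Fin n → Src S) (v : Fin n ⊕ Fin n → D), v ∘ Sum.inl = Subtype.val ∘ x →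
        (∀ i, MapsTo S (x i).1 (v (.inr i))) → (θ.Realize v ↔ δ.Realize x)) :
    Th ⊨ᵇ (matching L₁ L₂ n).imp (θ.iff (relativize (Formula.relabel Sum.inl δ))) := by
  intro M v xs
  rw [BoundedFormula.realize_imp, realize_matching, BoundedFormula.realize_iff,
    Subsingleton.elim xs default]
  intro hm
  have hS : Sat M.struc Th := M.is_model
  let x : Fin n → Src M.struc := fun i => ⟨v (.inl i), ((hTh.bookkeeping M _ hS).map _ _ (hm i)).1⟩
  exact (h M M.struc hS x v rfl hm).trans
    (realize_relativize_relabel M.struc Sum.inl δ v x rfl).symm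

/-- The explicit definition of a predicate in a model of the theory. -/
theorem ExplicitlyDefines.relMap_iff {n : ℕ} {P : L₁.Relations n} {δ : L₂.Formula (Fin n)}
    (h : ExplicitlyDefines Th P δ) {D : Type (max u₁ v₁ u₂ v₂)} [Nonempty D]
    {S : (sig L₁ L₂).Structure D} (hS : Sat S Th) (x : Fin n → Src S) (y : Fin n → Tgt S)
    (hxy : ∀ i, MapsTo S (x i).1 (y i).1) : (tgtModel S).RelMap P y ↔ δ.Realize x := by
  have : D ⊨ Th := hS
  have := h.realize_boundedFormula D
    (v := Sum.elim (Subtype.val ∘ x) (Subtype.val ∘ y)) (xs := default)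
  rw [BoundedFormula.realize_imp, realize_matching, BoundedFormula.realize_iff] at this
  refine Iff.trans ?_ ((this hxy).trans (realize_relativize_relabel S Sum.inl δ _ x rfl))
  exact Iff.rfl

theorem ImplicitlyDefinable.exists_explicit (hTh : DefinesTransformation Th) {n : ℕ}
    {P : L₁.Relations n} (hP : ImplicitlyDefinable Th P) :
    ∃ δ : L₂.Formula (Fin n), ExplicitlyDefines Th P δ := by
  obtain ⟨δ, hδ⟩ := hTh.exists_definition
    ((sym₁ P).formula fun i => (Term.var i : (sig L₁ L₂).Term (Fin n))) (by
      intro D E _ _ S S' hS hS' Z b a a' hba hba' h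
      exact Implicit.of_distinct_domains (Th := Th) (R := fun S a => (tgtModel S).RelMap P a) hTh
        (fun S ι hι a => push_relMap S hι (sym₁ P) fun i => (a i).1) hP hS hS' Z
        (a := fun i => ⟨a i, ((hTh.bookkeeping D S hS).map _ _ (hba i)).2⟩)
        (a' := fun i => ⟨a' i, ((hTh.bookkeeping E S' hS').map _ _ (hba' i)).2⟩) hba hba' h)
  refine ⟨δ, hTh.models_definition fun D _ S hS x v _ hm => ?_⟩
  exact hδ D S hS x (v ∘ Sum.inr) hm

theorem IdentityImplicitlyDefinable.exists_explicit (hTh : DefinesTransformation Th)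
    (h : IdentityImplicitlyDefinable Th) :
    ∃ ε : L₂.Formula (Fin 2), ExplicitlyDefinesIdentity Th ε := by
  obtain ⟨ε, hε⟩ := hTh.exists_definition
    (Term.equal (Term.var 0) (Term.var 1) : (sig L₁ L₂).Formula (Fin 2)) (by
      intro D E _ _ S S' hS hS' Z b a a' hba hba' heq
      rw [Formula.realize_equal] at heq ⊢
      exact Subtype.ext_iff.1 (Implicit.of_distinct_domains (Th := Th) hTh
        (R := fun _ a => a 0 = a 1)
        (fun S ι hι a => Subtype.ext_iff.trans (hι.eq_iff.trans Subtype.ext_iff.symm)) h hS hS' Z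
        (a := fun i => ⟨a i, ((hTh.bookkeeping D S hS).map _ _ (hba i)).2⟩)
        (a' := fun i => ⟨a' i, ((hTh.bookkeeping E S' hS').map _ _ (hba' i)).2⟩) hba hba'
        (Subtype.ext heq)))
  refine ⟨ε, hTh.models_definition fun D _ S hS x v _ hm => ?_⟩
  rw [← hε D S hS x (v ∘ Sum.inr) hm, Formula.realize_equal, Formula.realize_equal]
  rfl

end Explicit

/-! ### Correctness of the compositional translation -/

section Translation

variable [L₁.IsRelational] [L₂.IsRelational] {Th : (sig L₁ L₂).Theory}

theorem realize_term_eq_termVar {L : FirstOrder.Language.{u₁, v₁}} [L.IsRelational] {β : Type w}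
    {M : Type*} [L.Structure M] (t : L.Term β) (v : β → M) : t.realize v = v (termVar t) := by
  cases t with
  | var x => rfl
  | func f => exact isEmptyElim f

theorem realize_relabel_formula {L : FirstOrder.Language.{u₁, v₁}} {α β M : Type*} [L.Structure M]
    {n : ℕ} (φ : L.Formula β) (g : β → α ⊕ Fin n) (v : α → M) (xs : Fin n → M) :
    BoundedFormula.Realize (l := n) (BoundedFormula.relabel g φ) v xs ↔
      φ.Realize (Sum.elim v xs ∘ g) := by
  refine BoundedFormula.realize_relabel.trans (iff_of_eq ?_)
  exact congrArg (BoundedFormula.Realize φ (Sum.elim v xs ∘ g)) (Subsingleton.elim _ _)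

/-- The translation is correct, by induction on formulas. -/
theorem realize_translate (hTh : DefinesTransformation Th)
    {δ : ∀ n : ℕ, L₁.Relations n → L₂.Formula (Fin n)} {ε : L₂.Formula (Fin 2)}
    (hδ : ∀ n P, ExplicitlyDefines Th P (δ n P))
    {D : Type (max u₁ v₁ u₂ v₂)} [Nonempty D] {S : (sig L₁ L₂).Structure D} (hS : Sat S Th)
    {α : Type w} {n : ℕ} (φ : L₁.BoundedFormula α n)
    (hφ : IdentityFree φ ∨ ExplicitlyDefinesIdentity Th ε)
    (b : α → Src S) (a : α → Tgt S) (hba : ∀ i, MapsTo S (b i).1 (a i).1)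
    (xs : Fin n → Src S) (ys : Fin n → Tgt S) (hxy : ∀ i, MapsTo S (xs i).1 (ys i).1) :
    (translate δ ε φ).Realize b xs ↔ φ.Realize a ys := by
  have hvar : ∀ {n : ℕ} {xs : Fin n → Src S} {ys : Fin n → Tgt S},
      (∀ i, MapsTo S (xs i).1 (ys i).1) →
      ∀ i, MapsTo S (Sum.elim b xs i).1 (Sum.elim a ys i).1 := by
    rintro n xs ys hxy (i | i)
    · exact hba i
    · exact hxy i
  induction φ with
  | falsum => exact Iff.rfl
  | equal t₁ t₂ =>
    -- For an equation, `IdentityFree` is `False`, so `ε` must define identity.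
    have hε := hφ.resolve_left id
    rw [translate, realize_relabel_formula]
    refine (hε.eq_iff hS _ (Sum.elim a ys ∘ ![termVar t₁, termVar t₂])
      fun i => hvar hxy _).symm.trans ?_
    rw [BoundedFormula.Realize, realize_term_eq_termVar, realize_term_eq_termVar]
    rfl
  | rel P ts =>
    rw [translate, realize_relabel_formula]
    refine ((hδ _ P).relMap_iff hS _ (fun i => Sum.elim a ys (termVar (ts i)))
      fun i => hvar hxy _).symm.trans ?_
    rw [BoundedFormula.Realize]
    simp only [realize_term_eq_termVar]
  | imp φ ψ ih₁ ih₂ =>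
    rw [translate, BoundedFormula.realize_imp, BoundedFormula.realize_imp]
    exact imp_congr (ih₁ (hφ.imp_left And.left) xs ys hxy) (ih₂ (hφ.imp_left And.right) xs ys hxy)
  | all φ ih =>
    rw [translate, BoundedFormula.realize_all, BoundedFormula.realize_all]
    have hstep : ∀ (x : Src S) (y : Tgt S), MapsTo S x.1 y.1 →
        ((translate δ ε φ).Realize b (Fin.snoc xs x) ↔ φ.Realize a (Fin.snoc ys y)) := by
      refine fun x y h => ih hφ _ _ fun i => ?_
      refine Fin.lastCases ?_ (fun j => ?_) i
      · simpa only [Fin.snoc_last] using h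
      · simpa only [Fin.snoc_castSucc] using hxy j
    -- Elements of `N` are lifted because `T` is onto; elements of `M` have images because `T` is
    -- total.
    constructor
    · intro h y
      obtain ⟨x, hx⟩ := hTh.onto D S hS y.1 y.2
      exact (hstep ⟨x, ((hTh.bookkeeping D S hS).map _ _ hx).1⟩ y hx).1 (h _)
    · intro h x
      obtain ⟨y, hy, -⟩ := hTh.function D S hS x.1 x.2
      exact (hstep x ⟨y, ((hTh.bookkeeping D S hS).map _ _ hy).2⟩ hy).2 (h _)

theorem translates_translate (hTh : DefinesTransformation Th)
    {δ : ∀ n : ℕ, L₁.Relations n → L₂.Formula (Fin n)} {ε : L₂.Formula (Fin 2)}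
    (hδ : ∀ n P, ExplicitlyDefines Th P (δ n P)) {α : Type w} (φ : L₁.Formula α)
    (hφ : IdentityFree φ ∨ ExplicitlyDefinesIdentity Th ε) :
    Translates Th φ (translate δ ε φ) := fun _ _ _ hS b a hba =>
  realize_translate hTh hδ hS φ hφ b a hba _ _ fun i => i.elim0

end Translation

end CrossModel

theorem mainTheorem1 (L₁ : FirstOrder.Language.{u₁, v₁}) (L₂ : FirstOrder.Language.{u₂, v₂})
    [L₁.IsRelational] [L₂.IsRelational] (Th : (CrossModel.sig L₁ L₂).Theory)
    (hTh : CrossModel.DefinesTransformation Th) :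
    (∀ (n : ℕ) (P : L₁.Relations n), CrossModel.ImplicitlyDefinable Th P →
      ∃ δ : L₂.Formula (Fin n), CrossModel.ExplicitlyDefines Th P δ) ∧
    ((∀ (n : ℕ) (P : L₁.Relations n), CrossModel.ImplicitlyDefinable Th P) →
      ∃ (δ : ∀ n : ℕ, L₁.Relations n → L₂.Formula (Fin n)) (ε : L₂.Formula (Fin 2)),
        (∀ (n : ℕ) (P : L₁.Relations n), CrossModel.ExplicitlyDefines Th P (δ n P)) ∧
        (∀ (α : Type) (φ : L₁.Formula α), CrossModel.IdentityFree φ →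
          CrossModel.Translates Th φ (CrossModel.translate δ ε φ)) ∧
        (CrossModel.IdentityImplicitlyDefinable Th →
          CrossModel.ExplicitlyDefinesIdentity Th ε ∧
          ∀ (α : Type) (φ : L₁.Formula α),
            CrossModel.Translates Th φ (CrossModel.translate δ ε φ))) := by
  refine ⟨fun n P hP => hP.exists_explicit hTh, fun hP => ?_⟩
  choose δ hδ using fun n P => (hP n P).exists_explicit hTh
  -- `ε` must be fixed before identity is assumed implicitly definable. If it is not, any formula
  -- serves, and `⊥` is taken, since identity-free formulas never use `ε`.
  have hε : ∃ ε : L₂.Formula (Fin 2), CrossModel.IdentityImplicitlyDefinable Th →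
      CrossModel.ExplicitlyDefinesIdentity Th ε := by
    by_cases h : CrossModel.IdentityImplicitlyDefinable Th
    · obtain ⟨ε, hε⟩ := h.exists_explicit hTh
      exact ⟨ε, fun _ => hε⟩
    · exact ⟨⊥, fun h' => absurd h' h⟩
  obtain ⟨ε, hε⟩ := hε
  exact ⟨δ, ε, hδ, fun α φ hφ => CrossModel.translates_translate hTh hδ φ (.inl hφ), fun h =>
    ⟨hε h, fun α φ => CrossModel.translates_translate hTh hδ φ (.inr (hε h))⟩⟩
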